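/- Let $A$ (arcs, or resources) and $K$ (O/D pairs, or user groups) be finite sets, $K\neq\emptyset$, and for each $k\in K$ let $\mathcal S_k$ be a non-empty finite collection of non-empty subsets of $A$ (the paths, or strategies, of $k$). A cost function is a continuous, non-decreasing function $[0,\infty)\to[0,\infty)$. A game $\Gamma=(\tau,d)$ consists of cost functions $\tau=(\tau_a)_{a\in A}$ and demands $d=(d_k)_{k\in K}$, $d_k\ge 0$, such that the total demand $T(d)=\sum_k d_k$ is positive and $\tau_a(x)>0$ for all $a\in A$ and $x\in(0,T(d)]$. A flow is a family $f_{k,s}\ge 0$ ($k\in K$, $s\in\mathcal S_k$) with $\sum_{s\in\mathcal S_k}f_{k,s}=d_k$ for all $k$; it has the arc flows $f_a=\sum_k\sum_{s\in\mathcal S_k,\,a\in s}f_{k,s}$, the path costs $\tau_s(f)=\sum_{a\in s}\tau_a(f_a)$ and the total cost $C(\Gamma,f)=\sum_k\sum_{s\in\mathcal S_k}f_{k,s}\,\tau_s(f)$. A social optimum is a flow of minimum total cost; a Wardrop equilibrium is a flow such that $f_{k,s}>0$ implies $\tau_s(f)\le\tau_{s'}(f)$ for all $k\in K$ and $s,s'\in\mathcal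 S_k$. The price of anarchy $\rho(\Gamma)$ is the (worst) ratio of the total cost of a Wardrop equilibrium to that of a social optimum. For a vector $\tau$ of functions, the cost slice of $\tau$ is the set of all games $(\sigma,d)$ with $\sigma_a=\tau_a$ on $[0,T(d)]$ for all $a\in A$. A function $g$ is regularly varying with index $\beta$ if it is measurable and positive on some interval $[X,\infty)$ and $\lim_{T\to\infty}g(Tx)/g(T)=x^\beta$ for all $x>0$. (a) Let $\tau=(\tau_a)_{a\in A}$ be cost functions that are regularly varying with a common index $\beta>0$ and for which the limits $\lambda_{a,b}=\lim_{T\to\infty}\tau_a(T)/\tau_b(T)\in(0,\infty)$ exist for all $a,b\in A$. Then the cost slice of $\tau$ behaves well for growing demands, i.e., $\rho(\Gamma_n)\to 1$ for every sequence $(\Gamma_n)$ of games of the slice whose total demands tend to $\infty$. Moreover, for every $b\in A$ the deviation bound $$w(T)=\max_{a\in A,\;x\in[0,1]}\Big|\frac{\tau_a(Tx)}{\tau_b(T)}-\lambda_{a,b}\,x^\beta\Big|$$ tends to $0$ as $T\to\infty$, and $\rho(\Gamma)=1+O\big(\sqrt{w(T(d))}\big)$, i.e., there are constants $C,T_0>0$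 such that $|\rho(\Gamma)-1|\le C\sqrt{w(T(d))}$ for every game $\Gamma$ of the slice, with demand vector $d$, such that $T(d)\ge T_0$. (b) Let $\beta>0$, $\alpha\ge 0$ and $\zeta_a>0$ ($a\in A$) be constants and $\tau_a(x)=\zeta_a\,x^\beta\ln^\alpha(x+1)$. Then $\rho(\Gamma)=1+O\big(\sqrt{1/\ln(T(d)+1)}\big)$, i.e., there are constants $C,T_0>0$ such that $|\rho(\Gamma)-1|\le C\sqrt{1/\ln(T(d)+1)}$ for every game $\Gamma$ of the cost slice of $\tau$, with demand vector $d$, such that $T(d)\ge T_0$. -/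

import Mathlib

open Filter Topology

noncomputable section

/-- The combinatorial structure of a non-atomic congestion game: `A` is the set of resources
(arcs) and `K` the set of user groups (O/D pairs). Group `k` has a finite non-empty
collection of strategies (paths), each of which is a non-empty set of arcs. -/
structure CongestionStructure (A K : Type*) where
  strategies : K → Finset (Finset A)
  strategies_nonempty : ∀ k, (strategies k).Nonempty
  nonempty_of_mem : ∀ k, ∀ s ∈ strategies k, s.Nonempty

/-- A cost function: continuous, non-decreasing and non-negative on `[0, ∞)`. The values
at negative reals play no role. -/
structure IsCostFunction (g : ℝ → ℝ) : Prop where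
  continuousOn : ContinuousOn g (Set.Ici 0)
  monotoneOn : MonotoneOn g (Set.Ici 0)
  nonneg : ∀ x, 0 ≤ x → 0 ≤ g x

/-- A game with combinatorial structure `S`: a vector of cost functions and a demand vector,
such that the total demand `T` is positive and every cost function is positive on `(0, T]`. -/
structure CongestionGame {A K : Type*} [Fintype K] (S : CongestionStructure A K) where
  cost : A → ℝ → ℝ
  demand : K → ℝ
  isCostFunction : ∀ a, IsCostFunction (cost a)
  demand_nonneg : ∀ k, 0 ≤ demand k
  total_pos : 0 < ∑ k, demand k
  cost_pos : ∀ a x, 0 < x → x ≤ ∑ k, demand k → 0 < cost a x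

namespace CongestionGame

variable {A K : Type*} [Fintype K] [DecidableEq A] {S : CongestionStructure A K}

/-- The total demand `T(d)`. -/
def totalDemand (Γ : CongestionGame S) : ℝ := ∑ k, Γ.demand k

/-- `f k s` is the amount of the demand of group `k` that uses the strategy `s`
(only `s ∈ S.strategies k` is relevant). -/
def IsFlow (Γ : CongestionGame S) (f : K → Finset A → ℝ) : Prop :=
  (∀ k, ∀ s ∈ S.strategies k, 0 ≤ f k s) ∧
    ∀ k, ∑ s ∈ S.strategies k, f k s = Γ.demand k

/-- The flow value of the arc `a`. -/
def arcFlow (_Γ : CongestionGame S) (f : K → Finset A → ℝ) (a : A) : ℝ :=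
  ∑ k, ∑ s ∈ S.strategies k with a ∈ s, f k s

/-- The cost of the path `s` under the flow `f`. -/
def pathCost (Γ : CongestionGame S) (f : K → Finset A → ℝ) (s : Finset A) : ℝ :=
  ∑ a ∈ s, Γ.cost a (Γ.arcFlow f a)

/-- The total cost of all users under the flow `f`. -/
def totalCost (Γ : CongestionGame S) (f : K → Finset A → ℝ) : ℝ :=
  ∑ k, ∑ s ∈ S.strategies k, f k s * Γ.pathCost f s

/-- Social optimum: a flow of minimum total cost. -/
def IsSocialOptimum (Γ : CongestionGame S) (f : K → Finset A → ℝ) : Prop :=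
  Γ.IsFlow f ∧ ∀ g, Γ.IsFlow g → Γ.totalCost f ≤ Γ.totalCost g

/-- Wardrop equilibrium: every used path of a group is a cheapest path of that group. -/
def IsWardropEquilibrium (Γ : CongestionGame S) (f : K → Finset A → ℝ) : Prop :=
  Γ.IsFlow f ∧ ∀ k, ∀ s ∈ S.strategies k, ∀ s' ∈ S.strategies k,
    0 < f k s → Γ.pathCost f s ≤ Γ.pathCost f s'

/-- The price of anarchy: the worst ratio of the total cost of a Wardrop equilibrium to that
of a social optimum. -/
def priceOfAnarchy (Γ : CongestionGame S) : ℝ :=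
  sSup {r : ℝ | ∃ f g, Γ.IsWardropEquilibrium f ∧ Γ.IsSocialOptimum g ∧
    r = Γ.totalCost f / Γ.totalCost g}

end CongestionGame

/-- The cost slice of `τ`: all games whose cost functions agree with `τ` on `[0, T(d)]`. -/
def costSlice {A K : Type*} [Fintype K] (S : CongestionStructure A K) (τ : A → ℝ → ℝ) :
    Set (CongestionGame S) :=
  {Γ | ∀ a, ∀ x ∈ Set.Icc 0 Γ.totalDemand, Γ.cost a x = τ a x}

/-- The cost slice of `τ` behaves well for growing demands: the price of anarchy tends to 1
along every sequence of games of the slice whose total demand tends to infinity. -/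
def BehavesWellForGrowingDemands {A K : Type*} [Fintype K] [DecidableEq A]
    (S : CongestionStructure A K) (τ : A → ℝ → ℝ) : Prop :=
  ∀ Γ : ℕ → CongestionGame S, (∀ n, Γ n ∈ costSlice S τ) →
    Tendsto (fun n => (Γ n).totalDemand) atTop atTop →
    Tendsto (fun n => (Γ n).priceOfAnarchy) atTop (𝓝 1)

/-- `g` is regularly varying (at infinity) with index `β`: it is positive and measurable on
some `[X, ∞)`, and `g (T x) / g T → x ^ β` as `T → ∞` for every `x > 0`. -/
structure RegularlyVarying (g : ℝ → ℝ) (β : ℝ) : Prop where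
  eventually_pos_measurable :
    ∃ X : ℝ, (∀ x, X ≤ x → 0 < g x) ∧ Measurable (fun x : Set.Ici X => g x)
  tendsto : ∀ x : ℝ, 0 < x → Tendsto (fun T => g (T * x) / g T) atTop (𝓝 (x ^ β))

/-- The deviation bound
`w(T) = max_{a ∈ A, x ∈ [0,1]} |τ_a(T x) / τ_b(T) - lam_{a,b} x ^ β|`. -/
def deviationBound {A : Type*} (τ : A → ℝ → ℝ) (lam : A → A → ℝ) (β : ℝ) (b : A) (T : ℝ) : ℝ :=
  ⨆ p : A × Set.Icc (0 : ℝ) 1,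
    |τ p.1 (T * (p.2 : ℝ)) / τ b T - lam p.1 b * (p.2 : ℝ) ^ β|

end

/-!
Dividing arc flows by the total demand `T` and arc costs by a suitable `c(T)` turns a game of the
slice into a game with total demand `1` whose costs are uniformly within `w` of the monomials
`l a * x ^ β`. In the limit game, Wardrop equilibria minimise the total cost, because Beckmann's
potential is the total cost divided by `β + 1`. Quantitatively, the variational inequality for an
equilibrium `f` bounds its total cost by the cost of any flow `g` at the arc costs of `f`, and
Young's inequality `(β + 1) * (x ^ β * y) ≤ β * x ^ (β + 1) + y ^ (β + 1)` turns this into the bound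
`C(f) ≤ C(g) + O(w)`. Rescaled total costs are bounded away from `0`, so the price of anarchy is
`1 + O(w)`, which is even better than `1 + O(√w)`.

For regularly varying costs `c` is one of them, and `w(T) → 0` since pointwise convergence of
monotone functions to a continuous limit is uniform. For `ζ a * x ^ β * ln (x + 1) ^ α` one takes
`c(T) = T ^ β * ln (T + 1) ^ α`. Up to `O(|ln x| / ln (T + 1))` the quotient of the logarithms at
`T * x` and `T` is `1`, and `x ^ β * |ln x|` is bounded on `(0, 1]`, so `w(T) = O(1 / ln (T + 1))`.
-/

/-- Pólya's theorem: near `x`, monotonicity traps `F i` between its values at two points that do not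
depend on `i`. -/
lemma tendstoUniformlyOn_Icc_of_monotoneOn {ι : Type*} {p : Filter ι} {F : ι → ℝ → ℝ}
    {f : ℝ → ℝ} {a b : ℝ} (hF : ∀ᶠ i in p, MonotoneOn (F i) (Set.Icc a b))
    (hf : ContinuousOn f (Set.Icc a b))
    (hlim : ∀ x ∈ Set.Icc a b, Tendsto (fun i => F i x) p (𝓝 (f x))) :
    TendstoUniformlyOn F f p (Set.Icc a b) := by
  rw [← tendstoLocallyUniformlyOn_iff_tendstoUniformlyOn_of_compact isCompact_Icc,
    Metric.tendstoLocallyUniformlyOn_iff]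
  intro ε hε x hx
  obtain ⟨δ, hδ, hfδ⟩ := Metric.continuousOn_iff.1 hf x hx (ε / 3) (by positivity)
  have hu : max a (x - δ / 2) ∈ Set.Icc a b :=
    ⟨le_max_left _ _, max_le (hx.1.trans hx.2) (by linarith [hx.2])⟩
  have hv : min b (x + δ / 2) ∈ Set.Icc a b :=
    ⟨le_min (hx.1.trans hx.2) (by linarith [hx.1]), min_le_left _ _⟩
  set u := max a (x - δ / 2)
  set v := min b (x + δ / 2)
  have near {y : ℝ} (hy : y ∈ Set.Icc a b) (huy : u ≤ y) (hyv : y ≤ v) :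
      |f y - f x| < ε / 3 := by
    refine hfδ y hy (abs_lt.2 ⟨?_, ?_⟩)
    · linarith [le_max_right a (x - δ / 2)]
    · linarith [min_le_right b (x + δ / 2)]
  have huv : u ≤ v := max_le (le_min (hx.1.trans hx.2) (by linarith [hx.1]))
    (le_min (by linarith [hx.2]) (by linarith))
  have mem_nhds : Set.Icc a b ∩ Set.Icc (x - δ / 2) (x + δ / 2) ∈ 𝓝[Set.Icc a b] x :=
    inter_mem self_mem_nhdsWithin
      (mem_nhdsWithin_of_mem_nhds (Icc_mem_nhds (by linarith) (by linarith)))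
  refine ⟨_, mem_nhds, ?_⟩
  filter_upwards [hF, Metric.tendsto_nhds.1 (hlim u hu) (ε / 3) (by positivity),
    Metric.tendsto_nhds.1 (hlim v hv) (ε / 3) (by positivity)] with i mono hFu hFv y hy
  have huy : u ≤ y := max_le hy.1.1 hy.2.1
  have hyv : y ≤ v := le_min hy.1.2 hy.2.2
  have lower := mono hu hy.1 huy
  have upper := mono hy.1 hv hyv
  rw [Real.dist_eq, abs_lt] at hFu hFv ⊢
  have fu := abs_lt.1 (near hu le_rfl huv)
  have fv := abs_lt.1 (near hv huv le_rfl)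
  have fy := abs_lt.1 (near hy.1 huy hyv)
  constructor <;> linarith

lemma CongestionStructure.nonempty_arcs {A K : Type*} [Nonempty K] (S : CongestionStructure A K) :
    Nonempty A := by
  obtain ⟨k⟩ := ‹Nonempty K›
  obtain ⟨s, hs⟩ := S.strategies_nonempty k
  obtain ⟨a, -⟩ := S.nonempty_of_mem k s hs
  exact ⟨a⟩

lemma add_one_mul_rpow_mul_le {β x y : ℝ} (hβ : 0 ≤ β) (hx : 0 ≤ x) (hy : 0 ≤ y) :
    (β + 1) * (x ^ β * y) ≤ β * x ^ (β + 1) + y ^ (β + 1) := by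
  have hβ1 : 0 < β + 1 := by linarith
  have am_gm := Real.geom_mean_le_arith_mean2_weighted (w₁ := β / (β + 1)) (w₂ := 1 / (β + 1))
    (by positivity) (by positivity) (Real.rpow_nonneg hx (β + 1)) (Real.rpow_nonneg hy (β + 1))
    (by field_simp)
  rw [← Real.rpow_mul hx, ← Real.rpow_mul hy, mul_div_cancel₀ _ hβ1.ne',
    mul_one_div_cancel hβ1.ne', Real.rpow_one] at am_gm
  calc (β + 1) * (x ^ β * y)
      ≤ (β + 1) * (β / (β + 1) * x ^ (β + 1) + 1 / (β + 1) * y ^ (β + 1)) := by gcongr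
    _ = β * x ^ (β + 1) + y ^ (β + 1) := by field_simp

/-- The error term is `(β + 2) * w` because `|(β + 1) * y - β * x| ≤ β + 1`. -/
lemma add_one_mul_le_of_abs_sub_mul_rpow_le {β l w x y z z' : ℝ} (hβ : 0 ≤ β) (hl : 0 ≤ l)
    (hx : x ∈ Set.Icc 0 1) (hy : y ∈ Set.Icc 0 1) (hz : |z - l * x ^ β| ≤ w)
    (hz' : |z' - l * y ^ β| ≤ w) :
    (β + 1) * (z * y) ≤ β * (z * x) + z' * y + (β + 2) * w := by
  have hβ1 : 0 < β + 1 := by linarith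
  have young := mul_le_mul_of_nonneg_left (add_one_mul_rpow_mul_le hβ hx.1 hy.1) hl
  rw [Real.rpow_add_one' hx.1 hβ1.ne', Real.rpow_add_one' hy.1 hβ1.ne'] at young
  have weight_le : |(β + 1) * y - β * x| ≤ β + 1 :=
    abs_le.2 ⟨by nlinarith [hx.2, hy.1], by nlinarith [hx.1, hy.2]⟩
  have error_x : (z - l * x ^ β) * ((β + 1) * y - β * x) ≤ w * (β + 1) :=
    (le_abs_self _).trans <| (abs_mul _ _).trans_le <|
      mul_le_mul hz weight_le (abs_nonneg _) ((abs_nonneg _).trans hz)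
  have error_y : (l * y ^ β - z') * y ≤ w :=
    calc (l * y ^ β - z') * y ≤ w * y := by
          rw [abs_sub_comm] at hz'
          exact mul_le_mul_of_nonneg_right ((le_abs_self _).trans hz') hy.1
      _ ≤ w := mul_le_of_le_one_right ((abs_nonneg _).trans hz) hy.2
  linarith

namespace CongestionGame

lemma totalDemand_pos {A K : Type*} [Fintype K] {S : CongestionStructure A K}
    (Γ : CongestionGame S) : 0 < Γ.totalDemand :=
  Γ.total_pos

section Flows

variable {A K : Type*} [Fintype K] [DecidableEq A] {S : CongestionStructure A K}
  {Γ : CongestionGame S} {f g : K → Finset A → ℝ}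

lemma IsFlow.arcFlow_nonneg (hf : Γ.IsFlow f) (a : A) : 0 ≤ Γ.arcFlow f a :=
  Finset.sum_nonneg fun k _ => Finset.sum_nonneg fun s hs => hf.1 k s (Finset.mem_filter.1 hs).1

lemma IsFlow.arcFlow_le_totalDemand (hf : Γ.IsFlow f) (a : A) :
    Γ.arcFlow f a ≤ Γ.totalDemand := by
  refine Finset.sum_le_sum fun k _ => ?_
  rw [← hf.2 k]
  exact Finset.sum_le_sum_of_subset_of_nonneg (Finset.filter_subset _ _) fun s hs _ => hf.1 k s hs

lemma IsFlow.arcFlow_div_totalDemand_mem_Icc (hf : Γ.IsFlow f) (a : A) :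
    Γ.arcFlow f a / Γ.totalDemand ∈ Set.Icc (0 : ℝ) 1 :=
  ⟨div_nonneg (hf.arcFlow_nonneg a) Γ.totalDemand_pos.le,
    (div_le_one Γ.totalDemand_pos).2 (hf.arcFlow_le_totalDemand a)⟩

lemma sum_mul_sum_eq_sum_mul_arcFlow [Fintype A] (Γ : CongestionGame S) (f : K → Finset A → ℝ)
    (c : A → ℝ) :
    ∑ k, ∑ s ∈ S.strategies k, f k s * ∑ a ∈ s, c a = ∑ a, c a * Γ.arcFlow f a := by
  have path_sum (s : Finset A) (x : ℝ) : x * ∑ a ∈ s, c a = ∑ a, if a ∈ s then c a * x else 0 := by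
    simp [Finset.mul_sum, mul_comm]
  simp only [path_sum, arcFlow, Finset.mul_sum, Finset.sum_filter, mul_ite, mul_zero]
  rw [Finset.sum_comm]
  exact Finset.sum_congr rfl fun k _ => Finset.sum_comm

lemma totalCost_eq_sum_cost_mul_arcFlow [Fintype A] (Γ : CongestionGame S)
    (f : K → Finset A → ℝ) :
    Γ.totalCost f = ∑ a, Γ.cost a (Γ.arcFlow f a) * Γ.arcFlow f a :=
  Γ.sum_mul_sum_eq_sum_mul_arcFlow f _

lemma IsFlow.totalDemand_le_sum_arcFlow [Fintype A] (hf : Γ.IsFlow f) :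
    Γ.totalDemand ≤ ∑ a, Γ.arcFlow f a := by
  have sum_card := Γ.sum_mul_sum_eq_sum_mul_arcFlow f fun _ => 1
  simp only [one_mul] at sum_card
  rw [← sum_card]
  refine Finset.sum_le_sum fun k _ => ?_
  rw [← hf.2 k]
  refine Finset.sum_le_sum fun s hs => le_mul_of_one_le_right (hf.1 k s hs) ?_
  simpa using S.nonempty_of_mem k s hs

end Flows

section Reroute

variable {A K : Type*} [DecidableEq A] [DecidableEq K] {S : CongestionStructure A K}

/-- The flow obtained from `f` by moving all users of group `k` on path `s` to path `s'`. -/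
noncomputable def reroute (f : K → Finset A → ℝ) (k : K) (s s' : Finset A) : K → Finset A → ℝ :=
  f + Pi.single k (Pi.single s' (f k s) - Pi.single s (f k s))

lemma sum_reroute_mul (f : K → Finset A → ℝ) {k : K} {s s' : Finset A} (hs : s ∈ S.strategies k)
    (hs' : s' ∈ S.strategies k) (c : Finset A → ℝ) (j : K) :
    ∑ r ∈ S.strategies j, reroute f k s s' j r * c r
      = ∑ r ∈ S.strategies j, f j r * c r + if j = k then f k s * (c s' - c s) else 0 := by
  by_cases hjk : j = k
  · subst hjk
    simp [reroute, add_mul, sub_mul, mul_sub, Finset.sum_add_distrib, Finset.sum_sub_distrib,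
      Pi.single_apply, hs, hs']
  · simp [reroute, hjk]

end Reroute

section VariationalInequality

variable {A K : Type*} [Fintype K] [DecidableEq A] {S : CongestionStructure A K}
  {Γ : CongestionGame S} {f g : K → Finset A → ℝ}

lemma IsWardropEquilibrium.totalCost_le_sum_mul_pathCost (hf : Γ.IsWardropEquilibrium f)
    (hg : Γ.IsFlow g) :
    Γ.totalCost f ≤ ∑ k, ∑ s ∈ S.strategies k, g k s * Γ.pathCost f s := by
  refine Finset.sum_le_sum fun k _ => ?_
  obtain ⟨m, hm, hmin⟩ := Finset.exists_min_image _ (Γ.pathCost f) (S.strategies_nonempty k)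
  calc ∑ s ∈ S.strategies k, f k s * Γ.pathCost f s
      ≤ ∑ s ∈ S.strategies k, f k s * Γ.pathCost f m := by
        refine Finset.sum_le_sum fun s hs => ?_
        rcases (hf.1.1 k s hs).eq_or_lt with unused | used
        · simp [← unused]
        · exact mul_le_mul_of_nonneg_left (hf.2 k s hs m hm used) used.le
    _ = ∑ s ∈ S.strategies k, g k s * Γ.pathCost f m := by
        rw [← Finset.sum_mul, ← Finset.sum_mul, hf.1.2, hg.2]
    _ ≤ ∑ s ∈ S.strategies k, g k s * Γ.pathCost f s := Finset.sum_le_sum fun s hs =>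
        mul_le_mul_of_nonneg_left (hmin s hs) (hg.1 k s hs)

lemma IsFlow.reroute [DecidableEq K] (hf : Γ.IsFlow f) {k : K} {s s' : Finset A}
    (hs : s ∈ S.strategies k) (hs' : s' ∈ S.strategies k) : Γ.IsFlow (reroute f k s s') := by
  refine ⟨fun j r hr => ?_, fun j => ?_⟩
  · have hjr := hf.1 j r hr
    have hks := hf.1 k s hs
    rcases eq_or_ne j k with rfl | hjk
    · simp only [CongestionGame.reroute, Pi.add_apply, Pi.sub_apply, Pi.single_eq_same,
        Pi.single_apply]
      split_ifs <;> subst_vars <;> linarith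
    · simpa [CongestionGame.reroute, hjk] using hjr
  · simpa [hf.2 j] using sum_reroute_mul f hs hs' 1 j

lemma IsFlow.isWardropEquilibrium_of_totalCost_le (hf : Γ.IsFlow f)
    (hle : ∀ g, Γ.IsFlow g → Γ.totalCost f ≤ ∑ k, ∑ s ∈ S.strategies k, g k s * Γ.pathCost f s) :
    Γ.IsWardropEquilibrium f := by
  classical
  refine ⟨hf, fun k s hs s' hs' used => ?_⟩
  have rerouted_cost := hle _ (hf.reroute hs hs')
  simp only [sum_reroute_mul f hs hs', Finset.sum_add_distrib, Finset.sum_ite_eq',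
    Finset.mem_univ, if_true] at rerouted_cost
  have gain_nonneg : 0 ≤ f k s * (Γ.pathCost f s' - Γ.pathCost f s) :=
    (le_add_iff_nonneg_right _).1 rerouted_cost
  exact sub_nonneg.1 (nonneg_of_mul_nonneg_right gain_nonneg used)

end VariationalInequality

section Continuity

variable {A K : Type*} [Fintype K] {S : CongestionStructure A K}

lemma isClosed_setOf_isFlow (Γ : CongestionGame S) : IsClosed {f | Γ.IsFlow f} := by
  simp only [IsFlow, Set.ofPred_and, Set.ofPred_forall]
  refine (isClosed_iInter fun k => isClosed_iInter fun s => isClosed_iInter fun _ => ?_).inter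
    (isClosed_iInter fun k => ?_)
  · exact isClosed_le continuous_const (by fun_prop)
  · exact isClosed_eq (by fun_prop) continuous_const

lemma continuous_cost_max_zero (Γ : CongestionGame S) (a : A) :
    Continuous fun x => Γ.cost a (max x 0) :=
  (Γ.isCostFunction a).continuousOn.comp_continuous (by fun_prop) fun x => le_max_right x 0

/-- Beckmann's potential of an arc flow vector, whose gradient is the vector of arc costs. The cost
functions are extended to the negative reals by their values at `0`. -/
noncomputable def beckmannPotential [Fintype A] (Γ : CongestionGame S) (y : A → ℝ) : ℝ :=
  ∑ a, ∫ x in (0 : ℝ)..y a, Γ.cost a (max x 0)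

lemma hasFDerivAt_beckmannPotential [Fintype A] (Γ : CongestionGame S) (y : A → ℝ) :
    HasFDerivAt Γ.beckmannPotential
      (∑ a, Γ.cost a (max (y a) 0) • ContinuousLinearMap.proj (R := ℝ) (φ := fun _ : A => ℝ) a)
      y :=
  HasFDerivAt.fun_sum fun a _ =>
    ((Γ.continuous_cost_max_zero a).integral_hasStrictDerivAt 0 (y a)).hasDerivAt.comp_hasFDerivAt
      (f := fun z : A → ℝ => z a) y (hasFDerivAt_apply a y)

end Continuity

section Existence

variable {A K : Type*} [Fintype K] [DecidableEq A] {S : CongestionStructure A K}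
  {f : K → Finset A → ℝ}

/-- The set of arc flow vectors of all flows. Existence of minima is proved here rather than for
flows, since the values `f k s` with `s ∉ S.strategies k` are arbitrary. -/
def arcFlowVectors (Γ : CongestionGame S) : Set (A → ℝ) :=
  Γ.arcFlow '' {f | Γ.IsFlow f}

lemma IsFlow.exists_mem_Icc_arcFlow_eq {Γ : CongestionGame S} (hf : Γ.IsFlow f) :
    ∃ f' ∈ Set.Icc (0 : K → Finset A → ℝ) (fun k _ => Γ.demand k),
      Γ.IsFlow f' ∧ Γ.arcFlow f' = Γ.arcFlow f := by
  refine ⟨fun k s => if s ∈ S.strategies k then f k s else 0, ⟨fun k s => ?_, fun k s => ?_⟩,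
    ⟨fun k s hs => ?_, fun k => ?_⟩, ?_⟩
  · dsimp only
    split_ifs with hs
    exacts [hf.1 k s hs, le_rfl]
  · dsimp only
    split_ifs with hs
    · exact (Finset.single_le_sum (fun s hs => hf.1 k s hs) hs).trans_eq (hf.2 k)
    · exact Γ.demand_nonneg k
  · simpa only [hs, if_true] using hf.1 k s hs
  · rw [← hf.2 k]
    exact Finset.sum_congr rfl fun s hs => if_pos hs
  · funext a
    exact Finset.sum_congr rfl fun k _ => Finset.sum_congr rfl fun s hs =>
      if_pos (Finset.mem_filter.1 hs).1

lemma continuous_arcFlow (Γ : CongestionGame S) : Continuous Γ.arcFlow := by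
  unfold arcFlow
  fun_prop

lemma isCompact_arcFlowVectors (Γ : CongestionGame S) : IsCompact Γ.arcFlowVectors := by
  have image_eq : Γ.arcFlowVectors
      = Γ.arcFlow '' (Set.Icc 0 (fun k _ => Γ.demand k) ∩ {f | Γ.IsFlow f}) := by
    refine (Set.image_mono Set.inter_subset_right).antisymm' ?_
    rintro _ ⟨f, hf, rfl⟩
    obtain ⟨f', hf'Icc, hf', heq⟩ := IsFlow.exists_mem_Icc_arcFlow_eq hf
    exact ⟨f', ⟨hf'Icc, hf'⟩, heq⟩
  rw [image_eq]
  exact (isCompact_Icc.inter_right Γ.isClosed_setOf_isFlow).image Γ.continuous_arcFlow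

lemma convex_arcFlowVectors (Γ : CongestionGame S) : Convex ℝ Γ.arcFlowVectors := by
  rintro _ ⟨f, hf, rfl⟩ _ ⟨g, hg, rfl⟩ x y hx hy hxy
  refine ⟨x • f + y • g, ⟨fun k s hs => ?_, fun k => ?_⟩, ?_⟩
  · exact add_nonneg (mul_nonneg hx (hf.1 k s hs)) (mul_nonneg hy (hg.1 k s hs))
  · simp [Finset.sum_add_distrib, ← Finset.mul_sum, hf.2 k, hg.2 k, ← add_mul, hxy]
  · funext a
    simp [arcFlow, Finset.sum_add_distrib, Finset.mul_sum]

lemma arcFlowVectors_nonempty (Γ : CongestionGame S) : Γ.arcFlowVectors.Nonempty := by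
  choose p hp using S.strategies_nonempty
  refine Set.Nonempty.image _ ⟨fun k => Pi.single (p k) (Γ.demand k), fun k s _ => ?_, fun k => ?_⟩
  · exact (Pi.single_nonneg.2 (Γ.demand_nonneg k) : (0 : Finset A → ℝ) ≤ _) s
  · simp [Pi.single_apply, hp k]

lemma exists_isFlow_isMinOn (Γ : CongestionGame S) {F : (A → ℝ) → ℝ} (hF : Continuous F) :
    ∃ f, Γ.IsFlow f ∧ IsMinOn F Γ.arcFlowVectors (Γ.arcFlow f) := by
  obtain ⟨_, ⟨f, hf, rfl⟩, hmin⟩ :=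
    Γ.isCompact_arcFlowVectors.exists_isMinOn Γ.arcFlowVectors_nonempty hF.continuousOn
  exact ⟨f, hf, hmin⟩

theorem exists_isSocialOptimum [Finite A] (Γ : CongestionGame S) : ∃ f, Γ.IsSocialOptimum f := by
  cases nonempty_fintype A
  have cost_continuous : Continuous fun y : A → ℝ => ∑ a, Γ.cost a (max (y a) 0) * y a :=
    continuous_finsetSum _ fun a _ =>
      ((Γ.continuous_cost_max_zero a).comp (continuous_apply a)).mul (continuous_apply a)
  obtain ⟨f, hf, hmin⟩ := Γ.exists_isFlow_isMinOn cost_continuous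
  refine ⟨f, hf, fun g hg => ?_⟩
  simpa only [totalCost_eq_sum_cost_mul_arcFlow, max_eq_left (hf.arcFlow_nonneg _),
    max_eq_left (hg.arcFlow_nonneg _)] using isMinOn_iff.1 hmin _ ⟨g, hg, rfl⟩

/-- At a minimum of Beckmann's potential over the convex set of arc flow vectors, the first-order
optimality condition is the variational inequality of Wardrop equilibria. -/
theorem exists_isWardropEquilibrium [Finite A] (Γ : CongestionGame S) :
    ∃ f, Γ.IsWardropEquilibrium f := by
  cases nonempty_fintype A
  obtain ⟨f, hf, hmin⟩ := Γ.exists_isFlow_isMinOn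
    (continuous_iff_continuousAt.2 fun y => (Γ.hasFDerivAt_beckmannPotential y).continuousAt)
  refine ⟨f, hf.isWardropEquilibrium_of_totalCost_le fun g hg => ?_⟩
  have derivative_nonneg := hmin.localize.hasFDerivWithinAt_nonneg
    (Γ.hasFDerivAt_beckmannPotential _).hasFDerivWithinAt
    (sub_mem_posTangentConeAt_of_segment_subset
      (Γ.convex_arcFlowVectors.segment_subset ⟨f, hf, rfl⟩ ⟨g, hg, rfl⟩))
  simp only [max_eq_left (hf.arcFlow_nonneg _), sum_apply, mul_sub,
    smul_apply, ContinuousLinearMap.proj_apply, Pi.sub_apply, smul_eq_mul,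
    Finset.sum_sub_distrib, sub_nonneg] at derivative_nonneg
  rw [totalCost_eq_sum_cost_mul_arcFlow]
  exact derivative_nonneg.trans_eq (Γ.sum_mul_sum_eq_sum_mul_arcFlow g _).symm

theorem abs_priceOfAnarchy_sub_one_le [Finite A] (Γ : CongestionGame S) {e : ℝ}
    (hpos : ∀ g, Γ.IsSocialOptimum g → 0 < Γ.totalCost g)
    (hle : ∀ f g, Γ.IsWardropEquilibrium f → Γ.IsSocialOptimum g →
      Γ.totalCost f ≤ (1 + e) * Γ.totalCost g) :
    |Γ.priceOfAnarchy - 1| ≤ e := by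
  obtain ⟨f, hf⟩ := Γ.exists_isWardropEquilibrium
  obtain ⟨g, hg⟩ := Γ.exists_isSocialOptimum
  set ratios : Set ℝ := {r | ∃ f g, Γ.IsWardropEquilibrium f ∧ Γ.IsSocialOptimum g ∧
    r = Γ.totalCost f / Γ.totalCost g}
  have ratios_le : ∀ r ∈ ratios, r ≤ 1 + e := by
    rintro r ⟨f, g, hf, hg, rfl⟩
    exact (div_le_iff₀ (hpos g hg)).2 (hle f g hf hg)
  have mem_ratios : Γ.totalCost f / Γ.totalCost g ∈ ratios := ⟨f, g, hf, hg, rfl⟩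
  have one_le : 1 ≤ Γ.priceOfAnarchy :=
    ((one_le_div (hpos g hg)).2 (hg.2 f hf.1)).trans (le_csSup ⟨_, ratios_le⟩ mem_ratios)
  have le_one_add : Γ.priceOfAnarchy ≤ 1 + e := csSup_le ⟨_, mem_ratios⟩ ratios_le
  rw [abs_of_nonneg (sub_nonneg.2 one_le)]
  exact sub_le_iff_le_add'.2 le_one_add

end Existence

section NearMonomial

variable {A K : Type*} [Fintype K] {S : CongestionStructure A K}

/-- The game `Γ` is `w`-close to the limit game with monomial costs `l a * x ^ β` and total demand
`1`, once its arc flows are divided by the total demand and its arc costs by `c`. -/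
def IsNearMonomial (Γ : CongestionGame S) (β : ℝ) (l : A → ℝ) (c w : ℝ) : Prop :=
  ∀ a, ∀ x ∈ Set.Icc (0 : ℝ) 1, |Γ.cost a (Γ.totalDemand * x) / c - l a * x ^ β| ≤ w

lemma isNearMonomial_of_mem_costSlice {Γ : CongestionGame S} {τ : A → ℝ → ℝ}
    (hΓ : Γ ∈ costSlice S τ) {β c w : ℝ} {l : A → ℝ}
    (h : ∀ a, ∀ x ∈ Set.Icc (0 : ℝ) 1, |τ a (Γ.totalDemand * x) / c - l a * x ^ β| ≤ w) :
    Γ.IsNearMonomial β l c w := fun a x hx => by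
  rw [hΓ a _ ⟨mul_nonneg Γ.totalDemand_pos.le hx.1,
    mul_le_of_le_one_right Γ.totalDemand_pos.le hx.2⟩]
  exact h a x hx

namespace IsNearMonomial

variable [DecidableEq A] {Γ : CongestionGame S} {β c w : ℝ} {l : A → ℝ} {f g : K → Finset A → ℝ}

lemma abs_cost_arcFlow_div_sub_le (h : Γ.IsNearMonomial β l c w) (hf : Γ.IsFlow f) (a : A) :
    |Γ.cost a (Γ.arcFlow f a) / c - l a * (Γ.arcFlow f a / Γ.totalDemand) ^ β| ≤ w := by
  simpa only [mul_div_cancel₀ _ Γ.totalDemand_pos.ne'] using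
    h a _ (hf.arcFlow_div_totalDemand_mem_Icc a)

lemma add_one_mul_cost_mul_arcFlow_le (h : Γ.IsNearMonomial β l c w) (hβ : 0 ≤ β)
    (hl : ∀ a, 0 ≤ l a) (hc : 0 < c) (hf : Γ.IsFlow f) (hg : Γ.IsFlow g) (a : A) :
    (β + 1) * (Γ.cost a (Γ.arcFlow f a) * Γ.arcFlow g a)
      ≤ β * (Γ.cost a (Γ.arcFlow f a) * Γ.arcFlow f a)
        + Γ.cost a (Γ.arcFlow g a) * Γ.arcFlow g a + (β + 2) * w * (c * Γ.totalDemand) := by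
  have hT : 0 < Γ.totalDemand := Γ.totalDemand_pos
  have rescaled := mul_le_mul_of_nonneg_right
    (add_one_mul_le_of_abs_sub_mul_rpow_le hβ (hl a) (hf.arcFlow_div_totalDemand_mem_Icc a)
      (hg.arcFlow_div_totalDemand_mem_Icc a) (h.abs_cost_arcFlow_div_sub_le hf a)
      (h.abs_cost_arcFlow_div_sub_le hg a)) (mul_pos hc hT).le
  have rescale (z v : ℝ) : z / c * (v / Γ.totalDemand) * (c * Γ.totalDemand) = z * v := by
    field_simp
  simpa only [add_mul, mul_assoc, rescale] using rescaled

lemma totalCost_le_totalCost_add [Fintype A] (h : Γ.IsNearMonomial β l c w) (hβ : 0 ≤ β)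
    (hl : ∀ a, 0 ≤ l a) (hc : 0 < c) (hf : Γ.IsWardropEquilibrium f) (hg : Γ.IsFlow g) :
    Γ.totalCost f
      ≤ Γ.totalCost g + (β + 2) * (Fintype.card A * w) * (c * Γ.totalDemand) := by
  have variational_inequality :
      Γ.totalCost f ≤ ∑ a, Γ.cost a (Γ.arcFlow f a) * Γ.arcFlow g a :=
    (hf.totalCost_le_sum_mul_pathCost hg).trans_eq (Γ.sum_mul_sum_eq_sum_mul_arcFlow g _)
  have smoothness : (β + 1) * ∑ a, Γ.cost a (Γ.arcFlow f a) * Γ.arcFlow g a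
      ≤ β * Γ.totalCost f + Γ.totalCost g
        + (β + 2) * (Fintype.card A * w) * (c * Γ.totalDemand) :=
    calc _ ≤ ∑ a, (β * (Γ.cost a (Γ.arcFlow f a) * Γ.arcFlow f a)
            + Γ.cost a (Γ.arcFlow g a) * Γ.arcFlow g a + (β + 2) * w * (c * Γ.totalDemand)) := by
          rw [Finset.mul_sum]
          exact Finset.sum_le_sum fun a _ =>
            h.add_one_mul_cost_mul_arcFlow_le hβ hl hc hf.1 hg a
      _ = _ := by
          simp only [Finset.sum_add_distrib, ← Finset.mul_sum, ← totalCost_eq_sum_cost_mul_arcFlow,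
            Finset.sum_const, Finset.card_univ, nsmul_eq_mul]
          ring
  have := mul_le_mul_of_nonneg_left variational_inequality (add_nonneg hβ zero_le_one)
  linarith

lemma sub_mul_le_cost_mul_arcFlow (h : Γ.IsNearMonomial β l c w) (hβ : 0 ≤ β) {l₀ : ℝ} {a : A}
    (hl : l₀ ≤ l a) (hc : 0 < c) (hg : Γ.IsFlow g) :
    (l₀ * (Γ.arcFlow g a / Γ.totalDemand) ^ (β + 1) - w) * (c * Γ.totalDemand)
      ≤ Γ.cost a (Γ.arcFlow g a) * Γ.arcFlow g a := by
  set y := Γ.arcFlow g a / Γ.totalDemand with y_def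
  set z := Γ.cost a (Γ.arcFlow g a) / c with z_def
  have hT : 0 < Γ.totalDemand := Γ.totalDemand_pos
  have hy : y ∈ Set.Icc (0 : ℝ) 1 := hg.arcFlow_div_totalDemand_mem_Icc a
  have near : |z - l a * y ^ β| ≤ w := h.abs_cost_arcFlow_div_sub_le hg a
  have le_z : l₀ * y ^ β - w ≤ z := by
    have := mul_le_mul_of_nonneg_right hl (Real.rpow_nonneg hy.1 β)
    linarith [(abs_le.1 near).1]
  have le_z_mul : l₀ * y ^ (β + 1) - w ≤ z * y :=
    calc l₀ * y ^ (β + 1) - w ≤ l₀ * y ^ (β + 1) - w * y :=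
          sub_le_sub_left (mul_le_of_le_one_right ((abs_nonneg _).trans near) hy.2) _
      _ = (l₀ * y ^ β - w) * y := by rw [Real.rpow_add_one' hy.1 (by linarith)]; ring
      _ ≤ z * y := mul_le_mul_of_nonneg_right le_z hy.1
  calc _ ≤ z * y * (c * Γ.totalDemand) :=
        mul_le_mul_of_nonneg_right le_z_mul (mul_pos hc hT).le
    _ = _ := by rw [y_def, z_def]; field_simp

end IsNearMonomial

variable [DecidableEq A] {Γ : CongestionGame S} {β c w : ℝ} {l : A → ℝ} {g : K → Finset A → ℝ}

lemma IsFlow.one_div_le_sum_arcFlow_div_rpow [Fintype A] (hg : Γ.IsFlow g) (hβ : 0 ≤ β) :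
    1 / (Fintype.card A : ℝ) ^ β ≤ ∑ a, (Γ.arcFlow g a / Γ.totalDemand) ^ (β + 1) := by
  have one_le_sum : 1 ≤ ∑ a, Γ.arcFlow g a / Γ.totalDemand := by
    rw [← Finset.sum_div, one_le_div Γ.totalDemand_pos]
    exact hg.totalDemand_le_sum_arcFlow
  refine div_le_of_le_mul₀ (by positivity)
    (Finset.sum_nonneg fun a _ => Real.rpow_nonneg (hg.arcFlow_div_totalDemand_mem_Icc a).1 _) ?_
  calc 1 ≤ (∑ a, Γ.arcFlow g a / Γ.totalDemand) ^ (β + 1) :=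
        Real.one_le_rpow one_le_sum (by linarith)
    _ ≤ (Fintype.card A : ℝ) ^ β * ∑ a, (Γ.arcFlow g a / Γ.totalDemand) ^ (β + 1) := by
        simpa using Real.rpow_sum_le_const_mul_sum_rpow_of_nonneg Finset.univ
          (le_add_of_nonneg_left hβ) fun a _ => (hg.arcFlow_div_totalDemand_mem_Icc a).1
    _ = _ := mul_comm _ _

lemma IsNearMonomial.sub_mul_le_totalCost [Fintype A] (h : Γ.IsNearMonomial β l c w) (hβ : 0 ≤ β)
    {l₀ : ℝ} (hl₀ : 0 ≤ l₀) (hl : ∀ a, l₀ ≤ l a) (hc : 0 < c) (hg : Γ.IsFlow g) :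
    (l₀ / (Fintype.card A : ℝ) ^ β - Fintype.card A * w) * (c * Γ.totalDemand)
      ≤ Γ.totalCost g := by
  have hT : 0 < Γ.totalDemand := Γ.totalDemand_pos
  calc _ ≤ (l₀ * ∑ a, (Γ.arcFlow g a / Γ.totalDemand) ^ (β + 1) - Fintype.card A * w)
        * (c * Γ.totalDemand) := by
        rw [div_eq_mul_one_div]
        gcongr
        exact hg.one_div_le_sum_arcFlow_div_rpow hβ
    _ = ∑ a, (l₀ * (Γ.arcFlow g a / Γ.totalDemand) ^ (β + 1) - w) * (c * Γ.totalDemand) := by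
        simp [← Finset.sum_mul, ← Finset.mul_sum]
    _ ≤ Γ.totalCost g := by
        rw [totalCost_eq_sum_cost_mul_arcFlow]
        exact Finset.sum_le_sum fun a _ => h.sub_mul_le_cost_mul_arcFlow hβ (hl a) hc hg

theorem IsNearMonomial.abs_priceOfAnarchy_sub_one_le [Fintype A] (h : Γ.IsNearMonomial β l c w)
    (hβ : 0 ≤ β) {l₀ : ℝ} (hl₀ : 0 ≤ l₀) (hl : ∀ a, l₀ ≤ l a) (hc : 0 < c)
    (hw : Fintype.card A * w < l₀ / (Fintype.card A : ℝ) ^ β) :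
    |Γ.priceOfAnarchy - 1| ≤ (β + 2) * (Fintype.card A * w)
      / (l₀ / (Fintype.card A : ℝ) ^ β - Fintype.card A * w) := by
  set err := (β + 2) * (Fintype.card A * w)
  set κ := l₀ / (Fintype.card A : ℝ) ^ β - Fintype.card A * w
  have hκ : 0 < κ := sub_pos.2 hw
  have hcT : 0 < c * Γ.totalDemand := mul_pos hc Γ.totalDemand_pos
  have le_totalCost {g} (hg : Γ.IsFlow g) : κ * (c * Γ.totalDemand) ≤ Γ.totalCost g :=
    h.sub_mul_le_totalCost hβ hl₀ hl hc hg
  refine Γ.abs_priceOfAnarchy_sub_one_le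
    (fun g hg => (mul_pos hκ hcT).trans_le (le_totalCost hg.1)) fun f g hf hg => ?_
  have card_mul_nonneg : 0 ≤ Fintype.card A * w := by
    simpa using Finset.sum_nonneg (s := Finset.univ) fun a _ =>
      (abs_nonneg _).trans (h a 0 (by simp))
  have err_nonneg : 0 ≤ err := mul_nonneg (by linarith) card_mul_nonneg
  calc Γ.totalCost f ≤ Γ.totalCost g + err * (c * Γ.totalDemand) :=
        h.totalCost_le_totalCost_add hβ (fun a => hl₀.trans (hl a)) hc hf hg.1
    _ = Γ.totalCost g + err / κ * (κ * (c * Γ.totalDemand)) := by field_simp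
    _ ≤ Γ.totalCost g + err / κ * Γ.totalCost g := by
        have := mul_le_mul_of_nonneg_left (le_totalCost hg.1) (div_nonneg err_nonneg hκ.le)
        linarith
    _ = (1 + err / κ) * Γ.totalCost g := by ring

end NearMonomial

end CongestionGame

section Rates

variable {A K : Type*} [Fintype K] [DecidableEq A] {S : CongestionStructure A K}
  {τ : A → ℝ → ℝ} {w w' : ℝ → ℝ}

/-- The price of anarchy of the games `Γ` in the cost slice of `τ` is `1 + O(w(T))`, where `T` is
the total demand of `Γ`. -/
def HasPriceOfAnarchyRate (S : CongestionStructure A K) (τ : A → ℝ → ℝ) (w : ℝ → ℝ) : Prop :=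
  ∃ C > 0, ∃ T₀ > 0, ∀ Γ ∈ costSlice S τ, T₀ ≤ Γ.totalDemand →
    |Γ.priceOfAnarchy - 1| ≤ C * w Γ.totalDemand

lemma hasPriceOfAnarchyRate_of_eventually {C : ℝ} (hC : 0 < C)
    (h : ∀ᶠ T in atTop, ∀ Γ ∈ costSlice S τ, Γ.totalDemand = T → |Γ.priceOfAnarchy - 1| ≤ C * w T) :
    HasPriceOfAnarchyRate S τ w := by
  obtain ⟨T₀, hT₀⟩ := eventually_atTop.1 h
  exact ⟨C, hC, max T₀ 1, by positivity, fun Γ hΓ hT =>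
    hT₀ _ ((le_max_left _ _).trans hT) Γ hΓ rfl⟩

namespace HasPriceOfAnarchyRate

lemma of_eventually_le_mul (h : HasPriceOfAnarchyRate S τ w) {M : ℝ} (hM : 0 < M)
    (hw : ∀ᶠ T in atTop, w T ≤ M * w' T) : HasPriceOfAnarchyRate S τ w' := by
  obtain ⟨C, hC, T₀, -, hT₀⟩ := h
  refine hasPriceOfAnarchyRate_of_eventually (mul_pos hC hM) ?_
  filter_upwards [hw, eventually_ge_atTop T₀] with T hwT hT Γ hΓ rfl
  exact (hT₀ Γ hΓ hT).trans ((mul_le_mul_of_nonneg_left hwT hC.le).trans_eq (mul_assoc _ _ _).symm)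

lemma sqrt (h : HasPriceOfAnarchyRate S τ w) (hw : Tendsto w atTop (𝓝 0)) :
    HasPriceOfAnarchyRate S τ fun T => √(w T) := by
  refine h.of_eventually_le_mul one_pos ?_
  filter_upwards [hw.eventually_le_const one_pos] with T hT
  simpa only [one_mul] using Real.le_sqrt_self_iff.2 hT

lemma behavesWellForGrowingDemands (h : HasPriceOfAnarchyRate S τ w)
    (hw : Tendsto w atTop (𝓝 0)) : BehavesWellForGrowingDemands S τ := by
  obtain ⟨C, -, T₀, -, hT₀⟩ := h
  intro Γ hΓ hT
  rw [tendsto_iff_dist_tendsto_zero]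
  refine squeeze_zero' (Eventually.of_forall fun _ => dist_nonneg)
    ((hT.eventually_ge_atTop T₀).mono fun n hn => hT₀ (Γ n) (hΓ n) hn) ?_
  simpa only [mul_zero, Function.comp_apply] using (hw.comp hT).const_mul C

end HasPriceOfAnarchyRate

theorem hasPriceOfAnarchyRate_of_eventually_abs_sub_mul_rpow_le [Finite A] [Nonempty A] {β : ℝ}
    (hβ : 0 ≤ β) {l : A → ℝ} (hl : ∀ a, 0 < l a) {c : ℝ → ℝ} (hc : ∀ᶠ T in atTop, 0 < c T)
    (hw : Tendsto w atTop (𝓝 0))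
    (h : ∀ᶠ T in atTop, ∀ a, ∀ x ∈ Set.Icc (0 : ℝ) 1,
      |τ a (T * x) / c T - l a * x ^ β| ≤ w T) :
    HasPriceOfAnarchyRate S τ w := by
  cases nonempty_fintype A
  obtain ⟨a₀, ha₀⟩ := Finite.exists_min l
  set n : ℝ := (Fintype.card A : ℝ)
  set κ := l a₀ / n ^ β
  have hn : 0 < n := by positivity
  have hκ : 0 < κ := div_pos (hl a₀) (Real.rpow_pos_of_pos hn β)
  have small : ∀ᶠ T in atTop, n * w T < κ / 2 := by
    have := hw.const_mul n
    rw [mul_zero] at this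
    exact this.eventually_lt_const (half_pos hκ)
  refine hasPriceOfAnarchyRate_of_eventually (C := (β + 2) * n / (κ / 2)) (by positivity) ?_
  filter_upwards [hc, h, small] with T hcT hT hwT Γ hΓ rfl
  have w_nonneg : 0 ≤ w Γ.totalDemand := (abs_nonneg _).trans (hT a₀ 0 (by simp))
  calc |Γ.priceOfAnarchy - 1| ≤ (β + 2) * (n * w Γ.totalDemand) / (κ - n * w Γ.totalDemand) :=
        (Γ.isNearMonomial_of_mem_costSlice hΓ hT).abs_priceOfAnarchy_sub_one_le hβ (hl a₀).le ha₀
          hcT (by linarith)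
    _ ≤ (β + 2) * (n * w Γ.totalDemand) / (κ / 2) := by
        gcongr
        linarith
    _ = (β + 2) * n / (κ / 2) * w Γ.totalDemand := by ring

end Rates

section RegularVariation

variable {g h : ℝ → ℝ} {β l x : ℝ}

lemma RegularlyVarying.eventually_pos (hg : RegularlyVarying g β) : ∀ᶠ T in atTop, 0 < g T := by
  obtain ⟨X, hX, -⟩ := hg.eventually_pos_measurable
  exact eventually_atTop.2 ⟨X, hX⟩

lemma RegularlyVarying.tendsto_mul_div_of_pos (hg : RegularlyVarying g β)
    (hlim : Tendsto (fun T => h T / g T) atTop (𝓝 l)) (hx : 0 < x) :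
    Tendsto (fun T => h (T * x) / g T) atTop (𝓝 (l * x ^ β)) := by
  have hTx : Tendsto (fun T : ℝ => T * x) atTop atTop := tendsto_id.atTop_mul_const hx
  refine ((hlim.comp hTx).mul (hg.tendsto x hx)).congr' ?_
  filter_upwards [hTx.eventually hg.eventually_pos] with T hT
  exact div_mul_div_cancel₀ hT.ne'

lemma RegularlyVarying.tendsto_mul_div (hg : RegularlyVarying g β) (hβ : 0 < β)
    (hh : IsCostFunction h) (hlim : Tendsto (fun T => h T / g T) atTop (𝓝 l)) (hx : 0 ≤ x) :
    Tendsto (fun T => h (T * x) / g T) atTop (𝓝 (l * x ^ β)) := by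
  rcases hx.eq_or_lt with rfl | hx
  · rw [Real.zero_rpow hβ.ne', mul_zero]
    simp only [mul_zero]
    refine tendsto_order.2 ⟨fun y hy => ?_, fun y hy => ?_⟩
    · filter_upwards [hg.eventually_pos] with T hT
      exact hy.trans_le (div_nonneg (hh.nonneg 0 le_rfl) hT.le)
    · have limit_zero : Tendsto (fun x : ℝ => l * x ^ β) (𝓝[>] 0) (𝓝 0) := by
        have := ((Real.continuous_rpow_const hβ.le).tendsto 0).const_mul l
        rw [Real.zero_rpow hβ.ne', mul_zero] at this
        exact this.mono_left nhdsWithin_le_nhds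
      obtain ⟨x, hxy, hx⟩ :=
        ((limit_zero.eventually_lt_const hy).and self_mem_nhdsWithin).exists
      filter_upwards [hg.eventually_pos, eventually_ge_atTop 0,
        (hg.tendsto_mul_div_of_pos hlim hx).eventually_lt_const hxy] with T hgT hT hlt
      have hTx : 0 ≤ T * x := mul_nonneg hT (Set.mem_Ioi.1 hx).le
      exact (div_le_div_of_nonneg_right
        (hh.monotoneOn Set.self_mem_Ici hTx hTx) hgT.le).trans_lt hlt
  · exact hg.tendsto_mul_div_of_pos hlim hx

lemma RegularlyVarying.tendstoUniformlyOn_mul_div (hg : RegularlyVarying g β) (hβ : 0 < β)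
    (hh : IsCostFunction h) (hlim : Tendsto (fun T => h T / g T) atTop (𝓝 l)) :
    TendstoUniformlyOn (fun T x => h (T * x) / g T) (fun x => l * x ^ β) atTop
      (Set.Icc 0 1) := by
  refine tendstoUniformlyOn_Icc_of_monotoneOn ?_
    (continuous_const.mul (Real.continuous_rpow_const hβ.le)).continuousOn
    fun x hx => hg.tendsto_mul_div hβ hh hlim hx.1
  filter_upwards [hg.eventually_pos, eventually_ge_atTop 0] with T hgT hT x hx y hy hxy
  exact div_le_div_of_nonneg_right (hh.monotoneOn (mul_nonneg hT hx.1) (mul_nonneg hT hy.1)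
    (mul_le_mul_of_nonneg_left hxy hT)) hgT.le

end RegularVariation

section DeviationBound

variable {A : Type*} [Finite A] {τ : A → ℝ → ℝ} {β : ℝ} {lam : A → A → ℝ} {b : A}

lemma le_deviationBound (hβ : 0 ≤ β) (hτ : ∀ a, IsCostFunction (τ a)) {T : ℝ} (hT : 0 ≤ T)
    (a : A) {x : ℝ} (hx : x ∈ Set.Icc (0 : ℝ) 1) :
    |τ a (T * x) / τ b T - lam a b * x ^ β| ≤ deviationBound τ lam β b T := by
  let _ : TopologicalSpace A := ⊥
  have : DiscreteTopology A := ⟨rfl⟩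
  have deviation_continuous : Continuous fun p : A × Set.Icc (0 : ℝ) 1 =>
      |τ p.1 (T * (p.2 : ℝ)) / τ b T - lam p.1 b * (p.2 : ℝ) ^ β| := by
    refine continuous_prod_of_discrete_left.2 fun a => ?_
    have cost_continuous : Continuous fun x : Set.Icc (0 : ℝ) 1 => τ a (T * x) :=
      (hτ a).continuousOn.comp_continuous (by fun_prop) fun x => mul_nonneg hT x.2.1
    have rpow_continuous : Continuous fun x : Set.Icc (0 : ℝ) 1 => (x : ℝ) ^ β :=
      (Real.continuous_rpow_const hβ).comp continuous_subtype_val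
    exact ((cost_continuous.div_const (τ b T)).sub (rpow_continuous.const_mul (lam a b))).abs
  exact le_ciSup (isCompact_range deviation_continuous).bddAbove (a, ⟨x, hx⟩)

theorem tendsto_deviationBound (hβ : 0 < β) (hτ : ∀ a, IsCostFunction (τ a))
    (hb : RegularlyVarying (τ b) β)
    (hlim : ∀ a, Tendsto (fun T => τ a T / τ b T) atTop (𝓝 (lam a b))) :
    Tendsto (deviationBound τ lam β b) atTop (𝓝 0) := by
  refine tendsto_order.2 ⟨fun ε hε => Eventually.of_forall fun T =>
    hε.trans_le (Real.iSup_nonneg fun _ => abs_nonneg _), fun ε hε => ?_⟩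
  have uniform := eventually_all.2 fun a => Metric.tendstoUniformlyOn_iff.1
    (hb.tendstoUniformlyOn_mul_div hβ (hτ a) (hlim a)) (ε / 2) (half_pos hε)
  filter_upwards [uniform] with T hT
  refine (Real.iSup_le (fun p => ?_) (half_pos hε).le).trans_lt (half_lt_self hε)
  rw [← Real.dist_eq, dist_comm]
  exact (hT p.1 p.2 p.2.2).le

end DeviationBound

theorem hasPriceOfAnarchyRate_deviationBound {A K : Type*} [Finite A] [DecidableEq A] [Fintype K]
    {S : CongestionStructure A K} {τ : A → ℝ → ℝ} {β : ℝ} {lam : A → A → ℝ} {b : A} (hβ : 0 < β)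
    (hτ : ∀ a, IsCostFunction (τ a)) (hb : RegularlyVarying (τ b) β) (hlam : ∀ a, 0 < lam a b)
    (hlim : ∀ a, Tendsto (fun T => τ a T / τ b T) atTop (𝓝 (lam a b))) :
    HasPriceOfAnarchyRate S τ (deviationBound τ lam β b) := by
  have : Nonempty A := ⟨b⟩
  refine hasPriceOfAnarchyRate_of_eventually_abs_sub_mul_rpow_le hβ.le hlam hb.eventually_pos
    (tendsto_deviationBound hβ hτ hb hlim) ?_
  filter_upwards [eventually_ge_atTop 0] with T hT a x hx
  exact le_deviationBound hβ.le hτ hT a hx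

section LogarithmicFactor

lemma one_sub_log_div_log_le {T x : ℝ} (hT : 0 < T) (hx₀ : 0 < x) (hx₁ : x ≤ 1) :
    1 - Real.log (T * x + 1) / Real.log (T + 1) ≤ |Real.log x| / Real.log (T + 1) := by
  have log_pos : 0 < Real.log (T + 1) := Real.log_pos (by linarith)
  rw [one_sub_div log_pos.ne', abs_of_nonpos (Real.log_nonpos hx₀.le hx₁)]
  refine div_le_div_of_nonneg_right ?_ log_pos.le
  have log_le : Real.log (x * (T + 1)) ≤ Real.log (T * x + 1) :=
    Real.log_le_log (by positivity) (by linarith)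
  rw [Real.log_mul hx₀.ne' (by linarith)] at log_le
  linarith

lemma one_sub_rpow_le {α r : ℝ} (hα : 0 ≤ α) (hr₀ : 0 ≤ r) (hr₁ : r ≤ 1) :
    1 - r ^ α ≤ (1 + α) * (1 - r) := by
  have gap_nonneg : 0 ≤ α * (1 - r) := mul_nonneg hα (sub_nonneg.2 hr₁)
  rcases le_total α 1 with hα₁ | hα₁
  · have := Real.rpow_le_rpow_of_exponent_ge' hr₀ hr₁ hα hα₁
    rw [Real.rpow_one] at this
    linarith
  · have bernoulli := one_add_mul_self_le_rpow_one_add (s := r - 1) (by linarith) hα₁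
    rw [add_sub_cancel] at bernoulli
    linarith

lemma abs_rpow_mul_log_rpow_div_sub_le {β α T x : ℝ} (hβ : 0 < β) (hα : 0 ≤ α) (hT : 0 < T)
    (hx : x ∈ Set.Icc (0 : ℝ) 1) :
    |(T * x) ^ β * Real.log (T * x + 1) ^ α / (T ^ β * Real.log (T + 1) ^ α) - x ^ β|
      ≤ (1 + α) / β / Real.log (T + 1) := by
  have log_pos : 0 < Real.log (T + 1) := Real.log_pos (by linarith)
  rcases hx.1.eq_or_lt with rfl | hx₀
  · simp only [mul_zero, Real.zero_rpow hβ.ne', zero_mul, zero_div, sub_zero, abs_zero]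
    positivity
  have log_mul_nonneg : 0 ≤ Real.log (T * x + 1) := Real.log_nonneg (by nlinarith)
  set r : ℝ := Real.log (T * x + 1) / Real.log (T + 1) with r_def
  have r_nonneg : 0 ≤ r := div_nonneg log_mul_nonneg log_pos.le
  have r_le_one : r ≤ 1 := (div_le_one log_pos).2 <|
    Real.log_le_log (by positivity) (by linarith [mul_le_of_le_one_right hT.le hx.2])
  have deviation_eq : (T * x) ^ β * Real.log (T * x + 1) ^ α / (T ^ β * Real.log (T + 1) ^ α)
      - x ^ β = -(x ^ β * (1 - r ^ α)) := by
    rw [r_def, Real.div_rpow log_mul_nonneg log_pos.le, Real.mul_rpow hT.le hx₀.le]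
    field_simp
    ring
  have rpow_nonneg : 0 ≤ x ^ β := Real.rpow_nonneg hx₀.le β
  have log_mul_rpow_le : |Real.log x| * x ^ β ≤ 1 / β := by
    simpa only [abs_mul, abs_of_nonneg rpow_nonneg] using
      (Real.abs_log_mul_self_rpow_lt x β hx₀ hx.2 hβ).le
  rw [deviation_eq, abs_neg,
    abs_of_nonneg (mul_nonneg rpow_nonneg (sub_nonneg.2 (Real.rpow_le_one r_nonneg r_le_one hα)))]
  calc x ^ β * (1 - r ^ α) ≤ x ^ β * ((1 + α) * (1 - r)) := by
        gcongr
        exact one_sub_rpow_le hα r_nonneg r_le_one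
    _ ≤ x ^ β * ((1 + α) * (|Real.log x| / Real.log (T + 1))) := by
        gcongr
        exact one_sub_log_div_log_le hT hx₀ hx.2
    _ = (1 + α) / Real.log (T + 1) * (|Real.log x| * x ^ β) := by ring
    _ ≤ (1 + α) / Real.log (T + 1) * (1 / β) := by gcongr
    _ = (1 + α) / β / Real.log (T + 1) := by ring

lemma tendsto_one_div_log_add_one_atTop :
    Tendsto (fun T : ℝ => 1 / Real.log (T + 1)) atTop (𝓝 0) := by
  have log_tendsto : Tendsto (fun T : ℝ => Real.log (T + 1)) atTop atTop :=
    Real.tendsto_log_atTop.comp (tendsto_atTop_add_const_right _ _ tendsto_id)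
  exact (tendsto_inv_atTop_zero.comp log_tendsto).congr fun T => (one_div _).symm

theorem hasPriceOfAnarchyRate_one_div_log {A K : Type*} [Finite A] [Nonempty A] [DecidableEq A]
    [Fintype K] {S : CongestionStructure A K} {β α : ℝ} {ζ : A → ℝ} (hβ : 0 < β) (hα : 0 ≤ α)
    (hζ : ∀ a, 0 < ζ a) :
    HasPriceOfAnarchyRate S (fun a x => ζ a * x ^ β * Real.log (x + 1) ^ α)
      fun T => 1 / Real.log (T + 1) := by
  obtain ⟨a₀, ζ_le⟩ := Finite.exists_max ζ
  set M : ℝ := ζ a₀ * ((1 + α) / β)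
  have M_pos : 0 < M := mul_pos (hζ a₀) (by positivity)
  have rate_tendsto : Tendsto (fun T : ℝ => M * (1 / Real.log (T + 1))) atTop (𝓝 0) := by
    simpa only [mul_zero] using tendsto_one_div_log_add_one_atTop.const_mul M
  refine HasPriceOfAnarchyRate.of_eventually_le_mul ?_ M_pos (Eventually.of_forall fun _ => le_rfl)
  refine hasPriceOfAnarchyRate_of_eventually_abs_sub_mul_rpow_le hβ.le hζ
    (c := fun T => T ^ β * Real.log (T + 1) ^ α) ?_ rate_tendsto ?_
  · filter_upwards [eventually_gt_atTop 0] with T hT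
    have := Real.log_pos (show 1 < T + 1 by linarith)
    positivity
  · filter_upwards [eventually_gt_atTop 0] with T hT a x hx
    rw [mul_assoc, mul_div_assoc, ← mul_sub, abs_mul, abs_of_pos (hζ a)]
    calc _ ≤ ζ a₀ * ((1 + α) / β / Real.log (T + 1)) :=
          mul_le_mul (ζ_le a) (abs_rpow_mul_log_rpow_div_sub_le hβ hα hT hx) (abs_nonneg _)
            (hζ a₀).le
      _ = M * (1 / Real.log (T + 1)) := by ring

end LogarithmicFactor

theorem corollary2_general {A K : Type*} [Finite A] [Nonempty A] [DecidableEq A] [Fintype K]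
    (S : CongestionStructure A K) :
    (∀ (τ : A → ℝ → ℝ) (β : ℝ) (lam : A → A → ℝ) (b : A),
      0 < β →
      (∀ a, IsCostFunction (τ a)) →
      RegularlyVarying (τ b) β →
      (∀ a, 0 < lam a b) →
      (∀ a, Tendsto (fun T => τ a T / τ b T) atTop (𝓝 (lam a b))) →
      BehavesWellForGrowingDemands S τ ∧
        Tendsto (deviationBound τ lam β b) atTop (𝓝 0) ∧
        HasPriceOfAnarchyRate S τ (deviationBound τ lam β b)) ∧
    (∀ (β α : ℝ) (ζ : A → ℝ),
      0 < β → 0 ≤ α → (∀ a, 0 < ζ a) →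
      HasPriceOfAnarchyRate S (fun a x => ζ a * x ^ β * Real.log (x + 1) ^ α)
        fun T => 1 / Real.log (T + 1)) := by
  refine ⟨fun τ β lam b hβ hτ hb hlam hlim => ?_,
    fun β α ζ hβ hα hζ => hasPriceOfAnarchyRate_one_div_log hβ hα hζ⟩
  have deviation_tendsto := tendsto_deviationBound hβ hτ hb hlim
  have rate := hasPriceOfAnarchyRate_deviationBound (S := S) hβ hτ hb hlam hlim
  exact ⟨rate.behavesWellForGrowingDemands deviation_tendsto, deviation_tendsto, rate⟩

theorem corollary2 {A K : Type*} [Fintype A] [DecidableEq A] [Fintype K] [Nonempty K]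
    (S : CongestionStructure A K) :
    (∀ (τ : A → ℝ → ℝ) (β : ℝ) (lam : A → A → ℝ),
      0 < β →
      (∀ a, IsCostFunction (τ a)) →
      (∀ a, RegularlyVarying (τ a) β) →
      (∀ a b, 0 < lam a b) →
      (∀ a b, Tendsto (fun T => τ a T / τ b T) atTop (𝓝 (lam a b))) →
      BehavesWellForGrowingDemands S τ ∧
      ∀ b : A,
        Tendsto (deviationBound τ lam β b) atTop (𝓝 0) ∧
        ∃ C > 0, ∃ T₀ > 0, ∀ Γ ∈ costSlice S τ, T₀ ≤ Γ.totalDemand →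
          |Γ.priceOfAnarchy - 1| ≤ C * √(deviationBound τ lam β b Γ.totalDemand)) ∧
    (∀ (β α : ℝ) (ζ : A → ℝ),
      0 < β → 0 ≤ α → (∀ a, 0 < ζ a) →
      ∃ C > 0, ∃ T₀ > 0,
        ∀ Γ ∈ costSlice S (fun a x => ζ a * x ^ β * Real.log (x + 1) ^ α),
          T₀ ≤ Γ.totalDemand →
          |Γ.priceOfAnarchy - 1| ≤ C * √(1 / Real.log (Γ.totalDemand + 1))) := by
  have : Nonempty A := S.nonempty_arcs
  obtain ⟨regularly_varying, logarithmic⟩ := corollary2_general S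
  refine ⟨fun τ β lam hβ hτ hreg hlam hlim => ?_, fun β α ζ hβ hα hζ =>
    (logarithmic β α ζ hβ hα hζ).sqrt tendsto_one_div_log_add_one_atTop⟩
  have slice (b : A) := regularly_varying τ β lam b hβ hτ (hreg b) (hlam · b) (hlim · b)
  exact ⟨(slice (Classical.arbitrary A)).1, fun b =>
    ⟨(slice b).2.1, (slice b).2.2.sqrt (slice b).2.1⟩⟩
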